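/- Let $n=5$, let $t_1=0,\ t_2=1,\ t_3=x_1,\ t_4=x_2$ be distinct complex numbers, $t_5=\infty$, $D=t_1+\dots+t_5$, $L=\Omega^1_{\mathbb P^1}(D)$, and let $\nu_1,\dots,\nu_5\in\mathbb C\setminus\{0\}$. Let $z$ be the coordinate on $U_0=\mathbb P^1\setminus\{\infty\}$, $w=1/z$, and $$\omega_z=\frac{dz}{z(z-1)(z-x_1)(z-x_2)},\qquad \hat\nu_i=\nu_i\prod_{j\ne i,\,j\le 4}(t_i-t_j)\quad(i\le 4).$$ A $\boldsymbol\nu$-$\mathfrak{sl}_2$-parabolic Higgs bundle with a cyclic vector is $(E,\Phi,\varphi,[\sigma])$ with $E$ a rank $2$ vector bundle on $\mathbb P^1$, $\Phi:E\to E\otimes L$ an $\mathcal O$-linear map of trace $0$, $\varphi:\bigwedge^2E\cong\mathcal O(-1)$, such that $\mathrm{res}_{t_i}\Phi$ has eigenvalues $\pm\nu_i$ for $1\le i\le5$, and $[\sigma]$ the line spanned by a nonzero $\sigma\in H^0(\mathbb P^1,E)$. For a rank $2$ bundle $E$, a point $a$ and a line $l\subset E|_a$, put $(a,l)^{\rm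 low}(E)=\{s\in E\mid s(a)\in l\}$ and $(a,l)^{\rm up}(E)=(a,l)^{\rm low}(E)\otimes\mathcal O(a)$. Parameter spaces. Let $\mathcal K'$ be the surface obtained from the total space of $L$ over $U_0$, with coordinates $(q,p)$ ($p$ being the coefficient of $\omega_z$), by blowing up the eight points $(t_i,\pm\hat\nu_i)$, $i\le4$, and removing the proper transforms of the fibres $q=t_i$; it is the affine surface with functions $q,p,u_1,\dots,u_4$ and relations $p^2-\hat\nu_i^2=u_i(q-t_i)$. Let $$X=\{(k_1,k_2,\lambda)\in(\mathcal K')^2\times\mathbb C\mid p_2-p_1=\lambda(q_2-q_1),\ p_1\neq0,\ q_1\ne q_2\},$$ where $q_j,p_j$ and $u_{j,i}$ denote the coordinates of $k_j$. Let $\widehat X$ be the affine scheme of all $(k_1,k_2,\lambda,\mu_1,\dots,\mu_4)$ with $p_1\ne0$, $p_2-p_1=\lambda(q_2-q_1)$, $u_{2,i}-u_{1,i}=\mu_i(q_2-q_1)$ and $(p_1+p_2)\lambda=\mu_i(q_1-t_i)+u_{2,i}$ for $i\le4$. It contains $X$ as the open subset $q_1\ne q_2$; its points with $q_1=q_2\notin\{t_1,\dots,t_4\}$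 are exactly the $(k_1,k_2,\lambda)$ with $k_1=k_2$, $p_1\neq0$ and $\lambda\in\mathbb C$ arbitrary; at its points with $q_1=q_2=t_i$ one has $k_1=k_2$, $\lambda$ is the blowing-up parameter of this point, and $\mu_i\in\mathbb C$ is arbitrary. On $X$ put $a_1=\frac{p_1-p_2}{q_1-q_2}$, $a_0=-\frac{p_1q_2-p_2q_1}{q_1-q_2}$, $R_0=\mathrm{diag}(1,1/z)$ and $$A^0_z=\begin{pmatrix}a_1z+a_0&f_{12}(z)\\(z-q_1)(z-q_2)&-(a_1z+a_0)\end{pmatrix},$$ where $f_{12}$ is the polynomial of degree at most $4$ in $z$, with coefficients regular on $X$, for which $A^0_z\otimes\omega_z$ on $U_0$, $R_0^{-1}(A_z^0\otimes\omega_z)R_0$ near $\infty$ has residues with eigenvalues $\pm\nu_i$ at $t_i$ for all $i\le 5$; that is, the coefficient of $z^4$ in $f_{12}$ is $\nu_5^2$, and $f_{12}(t_i)=\frac{\hat\nu_i^2-(a_1t_i+a_0)^2}{(t_i-q_1)(t_i-q_2)}=\frac{u_{1,i}-u_{2,i}}{q_1-q_2}-a_1^2$ for $i\le4$. Let $$P_1=\begin{pmatrix}1&0\\0&z-q_1\end{pmatrix},\quad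 P_2=\begin{pmatrix}1&0\\\frac{q_1-q_2}{2p_1}&1\end{pmatrix},\quad P_3=\begin{pmatrix}\frac1{z-q_1}&0\\0&1\end{pmatrix}.$$ **Proposition.** The formula $$\Phi_X=\begin{cases}(P_1P_2P_3)^{-1}(A^0_z\otimes\omega_z)P_1P_2P_3&\text{on }U_0\\R_0^{-1}(A^0_z\otimes\omega_z)R_0&\text{on }U_\infty^{q_1}=\mathrm{Spec}\,\mathbb C[w,1/(q_1w-1)]\end{cases}$$ with transition matrix $(P_1P_2P_3)^{-1}R_0$ from the frame on $U_\infty^{q_1}$ to the frame on $U_0$ defines a family of $\boldsymbol\nu$-$\mathfrak{sl}_2$-parabolic Higgs bundles with a cyclic vector $(E_X,\Phi_X,\varphi_X,[\sigma_X])$ on $X\times\mathbb P^1$. This family, and the family $\Phi^0_X$ on $\mathcal O\oplus\mathcal O(-1)$ given by $A^0_z\otimes\omega_z$, extend to families on $\widehat X\times\mathbb P^1$. On $X$ and on $\widehat X$ the family $\Phi_X$ is obtained from $\Phi_X^0$ by a lower modification at $q_1$ along the eigenspace of $\Phi_X^0|_{q_1}$ with eigenvalue $p_1$, followed by an upper modification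 at $q_1$ along the eigenspace with eigenvalue $p_1$ of the resulting Higgs field at $q_1$. For the extended family, where $q_1\ne q_2$ the underlying bundle is $\mathcal O\oplus\mathcal O(-1)$; where $q_1=q_2$ it is $\mathcal O(1)\oplus\mathcal O(-2)$, and there the zero of the cyclic vector is $q_1$ (a simple zero, and no other). -/

import Mathlib

open Polynomial Matrix

universe u

noncomputable section

namespace HiggsP1

/-! ## The projective line over a ring and its two charts

`R` is a commutative ring (the ring of functions of an affine base) and `q : R`. The line `ℙ¹_R` is
covered by `U₀ = Spec R[z]` and `U_∞^q = Spec R[w, 1/(q w - 1)]` with `w = 1/z`, the complement of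
the point `z = 0` and of the section `z = q`. The overlap is `Spec R[z, 1/(z (z - q))]`. -/

/-- Functions on the overlap of the two charts, `R[z, 1/(z (z - q))]`. -/
abbrev Overlap {R : Type u} [CommRing R] (q : R) : Type u :=
  Localization.Away (X * (X - C q) : R[X])

/-- Functions on the chart at infinity, `R[w, 1/(q w - 1)]`; here the variable `X` is `w`. -/
abbrev ChartInf {R : Type u} [CommRing R] (q : R) : Type u :=
  Localization.Away (C q * X - 1 : R[X])

section Charts

variable {R : Type u} [CommRing R] (q : R)

/-- Restriction of functions from `U₀` to the overlap. -/
def res0 : R[X] →+* Overlap q := algebraMap R[X] (Overlap q)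

/-- The coordinate `z` on the overlap. -/
def zz : Overlap q := res0 q X

/-- The function `1 / (z (z - q))` on the overlap. -/
def invAll : Overlap q := IsLocalization.Away.invSelf (X * (X - C q) : R[X])

/-- The coordinate `w = 1/z` on the overlap. -/
def ww : Overlap q := res0 q (X - C q) * invAll q

/-- The function `1 / (z - q)` on the overlap. -/
def invZq : Overlap q := zz q * invAll q

lemma zz_mul_ww : zz q * ww q = 1 := by
  have h := IsLocalization.Away.mul_invSelf (S := Overlap q) (X * (X - C q) : R[X])
  rw [map_mul] at h
  rw [zz, ww, invAll, res0, ← mul_assoc]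
  exact h

lemma zq_mul_invZq : res0 q (X - C q) * invZq q = 1 := by
  rw [← zz_mul_ww q, ww, invZq]
  ring

lemma isUnit_inf :
    IsUnit (eval₂RingHom ((res0 q).comp C) (ww q) (C q * X - 1 : R[X])) := by
  have h1 := zz_mul_ww q
  have h2 := zq_mul_invZq q
  refine IsUnit.of_mul_eq_one (-(zz q * invZq q)) ?_
  have h3 : res0 q (X - C q) = zz q - res0 q (C q) := by rw [map_sub, zz]
  rw [h3] at h2
  simp only [coe_eval₂RingHom, eval₂_sub, eval₂_mul, eval₂_C, eval₂_X, eval₂_one,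
    RingHom.comp_apply]
  linear_combination h2 - res0 q (C q) * invZq q * h1

/-- Restriction of functions from `U_∞^q` to the overlap, `w ↦ 1/z`. -/
def resInf : ChartInf q →+* Overlap q :=
  IsLocalization.Away.lift (C q * X - 1 : R[X]) (isUnit_inf q)

lemma isUnit_zero : IsUnit (evalRingHom (0 : R) (C q * X - 1 : R[X])) := by
  simp

/-- Value of a function on `U_∞^q` at the point at infinity `w = 0`. -/
def evalInf : ChartInf q →+* R :=
  IsLocalization.Away.lift (C q * X - 1 : R[X]) (isUnit_zero q)

variable {S : Type u} [CommRing S] (f : R →+* S)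

lemma isUnit_overlap :
    IsUnit ((res0 (f q)).comp (mapRingHom f) (X * (X - C q) : R[X])) := by
  have h := IsLocalization.Away.algebraMap_isUnit (S := Overlap (f q))
    (X * (X - C (f q)) : S[X])
  simpa [res0] using h

/-- Change of base along `f : R → S` for functions on the overlap. -/
def overlapMap : Overlap q →+* Overlap (f q) :=
  IsLocalization.Away.lift (X * (X - C q) : R[X]) (isUnit_overlap q f)

lemma isUnit_chartInf :
    IsUnit ((algebraMap S[X] (ChartInf (f q))).comp (mapRingHom f) (C q * X - 1 : R[X])) := by
  have h := IsLocalization.Away.algebraMap_isUnit (S := ChartInf (f q)) (C (f q) * X - 1 : S[X])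
  simpa using h

/-- Change of base along `f : R → S` for functions on the chart at infinity. -/
def chartInfMap : ChartInf q →+* ChartInf (f q) :=
  IsLocalization.Away.lift (C q * X - 1 : R[X]) (isUnit_chartInf q f)

end Charts

/-! ## Bundles with a Higgs field -/

/-- A rank two vector bundle `E` on `ℙ¹_R` with a morphism `Φ : E → E ⊗ L`, `L = Ω¹(D)`,
`D = t₁ + t₂ + t₃ + t₄ + ∞`, given by gluing along the two charts.

* `T` is the transition matrix: the frames are related by `e_∞ = e₀ T`.
* `L` has the generator `ω_z = dz / ∏ (z - tᵢ)` on `U₀` and the generator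
  `ω_w = dw / (w ∏ (1 - tᵢ w))` at infinity, and `ω_z = - w³ ω_w`.
* `Φ₀` and `Φ∞` are the matrices of `Φ` with respect to these frames and generators. -/
structure HiggsPair (R : Type u) [CommRing R] (q : R) where
  T : Matrix (Fin 2) (Fin 2) (Overlap q)
  isUnit_det_T : IsUnit T.det
  Φ₀ : Matrix (Fin 2) (Fin 2) R[X]
  Φinf : Matrix (Fin 2) (Fin 2) (ChartInf q)
  glue : T * Φinf.map (resInf q) = (-(ww q) ^ 3) • (Φ₀.map (res0 q) * T)

/-- The transition matrix `R_k = diag(z^k, z^(-k-1))` of `𝒪(k) ⊕ 𝒪(-k-1)`. -/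
def splitT {R : Type u} [CommRing R] (q : R) (k : ℕ) : Matrix (Fin 2) (Fin 2) (Overlap q) :=
  !![zz q ^ k, 0; 0, ww q ^ (k + 1)]

namespace HiggsPair

variable {R : Type u} [CommRing R] {q : R}

/-- The underlying vector bundle is isomorphic to `𝒪(k) ⊕ 𝒪(-k-1)`: invertible changes of the
frame on each chart bring the transition matrix to `R_k`. -/
def HasBundleType (E : HiggsPair R q) (k : ℕ) : Prop :=
  ∃ (G₀ : GL (Fin 2) R[X]) (Ginf : GL (Fin 2) (ChartInf q)),
    E.T * Ginf.1.map (resInf q) = G₀.1.map (res0 q) * splitT q k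

/-- The fibre `Φ|_q` of the Higgs field at `z = q`, in the frame `e₀` and the generator `ω_z`. -/
def fiberAt (E : HiggsPair R q) : Matrix (Fin 2) (Fin 2) R := E.Φ₀.map (eval q)

/-- The eigenspace of `Φ|_q` in the fibre `E|_q = R²` for the eigenvalue `p`. -/
def eigenspaceAt (E : HiggsPair R q) (p : R) : Submodule R (Fin 2 → R) :=
  LinearMap.ker (Matrix.toLin' (E.fiberAt - p • (1 : Matrix (Fin 2) (Fin 2) R)))

/-- `E'` is the lower modification `(q, l)^low (E)`, the subsheaf of the sections of `E` with value
at `q` in `l`, with the restricted Higgs field. Here `l` is a line in the fibre `E|_q`, spanned by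
the first vector of a basis. The inclusion `E' → E` is given by `M₀` and `Minf` in the frames; it
is an isomorphism on the chart at infinity, which does not meet `z = q`. -/
def IsLowerModification (E E' : HiggsPair R q) (l : Submodule R (Fin 2 → R)) : Prop :=
  (∃ B : GL (Fin 2) R, l = Submodule.span R {B.1 *ᵥ ![1, 0]}) ∧
  ∃ (M₀ : Matrix (Fin 2) (Fin 2) R[X]) (Minf : GL (Fin 2) (ChartInf q)),
    Function.Injective (fun s => M₀ *ᵥ s) ∧
    Set.range (fun s => M₀ *ᵥ s) = {s | (fun i => (s i).eval q) ∈ l} ∧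
    M₀.map (res0 q) * E'.T = E.T * Minf.1.map (resInf q) ∧
    E.Φ₀ * M₀ = M₀ * E'.Φ₀ ∧
    E.Φinf * Minf.1 = Minf.1 * E'.Φinf

/-- `E' = E ⊗ 𝒪(q)`, where `𝒪(q)` has the generators `1 / (z - q)` on `U₀` and `1` on `U_∞^q`. -/
def IsTwist (E E' : HiggsPair R q) : Prop :=
  E'.T = res0 q (X - C q) • E.T ∧ E'.Φ₀ = E.Φ₀ ∧ E'.Φinf = E.Φinf

/-- `E'` is the upper modification `(q, l)^up (E) = (q, l)^low (E) ⊗ 𝒪(q)`. -/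
def IsUpperModification (E E' : HiggsPair R q) (l : Submodule R (Fin 2 → R)) : Prop :=
  ∃ E₁ : HiggsPair R q, E.IsLowerModification E₁ l ∧ E₁.IsTwist E'

variable [Algebra ℂ R]

/-- Residue of `Φ` at the finite pole `tᵢ`, in the frame `e₀`. -/
def residue (t : Fin 4 → ℂ) (E : HiggsPair R q) (i : Fin 4) : Matrix (Fin 2) (Fin 2) R :=
  algebraMap ℂ R (∏ j ∈ Finset.univ.erase i, (t i - t j))⁻¹ •
    E.Φ₀.map (eval (algebraMap ℂ R (t i)))

/-- Residue of `Φ` at infinity, in the frame `e_∞`. -/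
def residueInf (E : HiggsPair R q) : Matrix (Fin 2) (Fin 2) R := E.Φinf.map (evalInf q)

end HiggsPair

/-- A family over `Spec R` of `ν`-`𝔰𝔩₂`-parabolic Higgs bundles on `ℙ¹` with a cyclic vector, with
poles `t 0, …, t 3` and `∞`.

* `φ₀`, `φinf` give the isomorphism `⋀² E ≅ 𝒪(-1)`: `f_∞ = z⁻¹ f₀` for the generators of `𝒪(-1)`,
  and `e₀ ∧ e₀ ↦ φ₀ f₀`, `e_∞ ∧ e_∞ ↦ φinf f_∞`.
* `σ₀`, `σinf` are the coordinates of a global section `σ` of `E` which is not zero on the fibre of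
  the family over any point of `Spec R`; it generates the line `[σ]`. -/
structure ParabolicHiggs (t : Fin 4 → ℂ) (ν : Fin 5 → ℂ) (R : Type u) [CommRing R] [Algebra ℂ R]
    (q : R) extends HiggsPair R q where
  φ₀ : R[X]ˣ
  φinf : (ChartInf q)ˣ
  glue_φ : T.det * res0 q φ₀ = ww q * resInf q φinf
  trace_zero : Φ₀.trace = 0 ∧ Φinf.trace = 0
  residue_eigenvalues : ∀ i : Fin 4, (toHiggsPair.residue t i).charpoly =
    (X - C (algebraMap ℂ R (ν i.castSucc))) * (X + C (algebraMap ℂ R (ν i.castSucc)))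
  residueInf_eigenvalues : toHiggsPair.residueInf.charpoly =
    (X - C (algebraMap ℂ R (ν 4))) * (X + C (algebraMap ℂ R (ν 4)))
  σ₀ : Fin 2 → R[X]
  σinf : Fin 2 → ChartInf q
  glue_σ : (fun i => res0 q (σ₀ i)) = T *ᵥ fun i => resInf q (σinf i)
  σ_ne_zero : ∀ m : Ideal R, m.IsPrime → ∃ i, (σ₀ i).map (Ideal.Quotient.mk m) ≠ 0

/-- `E'` is the pull-back of the family `E` along `Spec S → Spec R`. -/
structure ParabolicHiggs.IsBaseChange {t : Fin 4 → ℂ} {ν : Fin 5 → ℂ} {R S : Type u} [CommRing R]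
    [Algebra ℂ R] [CommRing S] [Algebra ℂ S] (f : R →+* S) {q : R} (E : ParabolicHiggs t ν R q)
    (E' : ParabolicHiggs t ν S (f q)) : Prop where
  T : E'.T = E.T.map (overlapMap q f)
  Φ₀ : E'.Φ₀ = E.Φ₀.map (Polynomial.map f)
  Φinf : E'.Φinf = E.Φinf.map (chartInfMap q f)
  φ₀ : (E'.φ₀ : S[X]) = (E.φ₀ : R[X]).map f
  φinf : (E'.φinf : ChartInf (f q)) = chartInfMap q f E.φinf
  σ₀ : ∀ i, E'.σ₀ i = (E.σ₀ i).map f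
  σinf : ∀ i, E'.σinf i = chartInfMap q f (E.σinf i)

/-! ## The parameter spaces

They are affine schemes, described by their `R`-points, natural in the `ℂ`-algebra `R`. -/

/-- `ν̂ᵢ = νᵢ ∏_{j ≠ i} (tᵢ - tⱼ)`. -/
def nuHat (t : Fin 4 → ℂ) (ν : Fin 5 → ℂ) (i : Fin 4) : ℂ :=
  ν i.castSucc * ∏ j ∈ Finset.univ.erase i, (t i - t j)

/-- `R`-points of the part of `𝒦₅'` over `ℙ¹ ∖ {∞}`. The coordinates `(q, p)` are those of the total
space of `L` with respect to `ω_z`. Blowing up the two points `(tᵢ, ±ν̂ᵢ)`, that is, the ideal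
`(q - tᵢ, p² - ν̂ᵢ²)`, and removing the proper transform of the fibre `q = tᵢ` amounts to adjoining
`uᵢ = (p² - ν̂ᵢ²) / (q - tᵢ)`. On the exceptional curve over `(tᵢ, ε ν̂ᵢ)` one has
`uᵢ = 2 ε ν̂ᵢ v` with the usual parameter `v = (p - ε ν̂ᵢ) / (q - tᵢ)`. -/
@[ext]
structure KPoint (t : Fin 4 → ℂ) (ν : Fin 5 → ℂ) (R : Type u) [CommRing R] [Algebra ℂ R] where
  q : R
  p : R
  u : Fin 4 → R
  rel : ∀ i, p ^ 2 - algebraMap ℂ R (nuHat t ν i) ^ 2 = u i * (q - algebraMap ℂ R (t i))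

/-- `R`-points of `X`: pairs of points of `𝒦₅'` and `λ` with `p₂ - p₁ = λ (q₂ - q₁)`, `p₁ ≠ 0` and
`q₂ - q₁ ≠ 0` everywhere on `Spec R`. -/
structure XPoint (t : Fin 4 → ℂ) (ν : Fin 5 → ℂ) (R : Type u) [CommRing R] [Algebra ℂ R] where
  k₁ : KPoint t ν R
  k₂ : KPoint t ν R
  lam : R
  rel : k₂.p - k₁.p = lam * (k₂.q - k₁.q)
  isUnit_p : IsUnit k₁.p
  isUnit_q : IsUnit (k₂.q - k₁.q)

/-- `R`-points of `X̂`: the two points of `𝒦₅'` may coincide, in which case `λ` together with the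
`μᵢ` is the slope of a tangent direction of `𝒦₅'` transversal to the fibre of `𝒦₅' → ℙ¹`.
The relation `tangent` holds automatically where `q₁ ≠ q₂`; where `q₁ = q₂` is not a pole it
determines all the `μᵢ` from `λ`; where `q₁ = q₂ = tᵢ` it gives `λ = v`, the blowing-up parameter
of the point, and `μᵢ`, the difference quotient of `uᵢ`, is free. -/
@[ext]
structure XHatPoint (t : Fin 4 → ℂ) (ν : Fin 5 → ℂ) (R : Type u) [CommRing R] [Algebra ℂ R] where
  k₁ : KPoint t ν R
  k₂ : KPoint t ν R
  lam : R
  mu : Fin 4 → R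
  rel : k₂.p - k₁.p = lam * (k₂.q - k₁.q)
  rel_u : ∀ i, k₂.u i - k₁.u i = mu i * (k₂.q - k₁.q)
  tangent : ∀ i, (k₁.p + k₂.p) * lam = mu i * (k₁.q - algebraMap ℂ R (t i)) + k₂.u i
  isUnit_p : IsUnit k₁.p

section Points

variable {t : Fin 4 → ℂ} {ν : Fin 5 → ℂ} {R : Type u} [CommRing R] [Algebra ℂ R]

/-- The inclusion of `X` in `X̂`. -/
def XPoint.toXHat (x : XPoint t ν R) : XHatPoint t ν R where
  k₁ := x.k₁
  k₂ := x.k₂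
  lam := x.lam
  mu i := (x.k₂.u i - x.k₁.u i) * Ring.inverse (x.k₂.q - x.k₁.q)
  rel := x.rel
  rel_u i := by rw [mul_assoc, Ring.inverse_mul_cancel _ x.isUnit_q, mul_one]
  tangent i := by
    have h := Ring.inverse_mul_cancel _ x.isUnit_q
    refine x.isUnit_q.mul_right_cancel ?_
    linear_combination (-(x.k₂.u i - x.k₁.u i) * (x.k₁.q - algebraMap ℂ R (t i))) * h
      - (x.k₁.p + x.k₂.p) * x.rel + x.k₂.rel i - x.k₁.rel i
  isUnit_p := x.isUnit_p

variable {S : Type u} [CommRing S] [Algebra ℂ S]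

/-- Functoriality of `𝒦₅'`. -/
def KPoint.map (f : R →ₐ[ℂ] S) (k : KPoint t ν R) : KPoint t ν S where
  q := f k.q
  p := f k.p
  u i := f (k.u i)
  rel i := by simpa using congrArg f (k.rel i)

/-- Functoriality of `X̂`. -/
def XHatPoint.map (f : R →ₐ[ℂ] S) (x : XHatPoint t ν R) : XHatPoint t ν S where
  k₁ := x.k₁.map f
  k₂ := x.k₂.map f
  lam := f x.lam
  mu i := f (x.mu i)
  rel := by simpa [KPoint.map] using congrArg f x.rel
  rel_u i := by simpa [KPoint.map] using congrArg f (x.rel_u i)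
  tangent i := by simpa [KPoint.map] using congrArg f (x.tangent i)
  isUnit_p := x.isUnit_p.map f

/-- A point `k` of `𝒦₅'` with `p ≠ 0` that does not lie over a pole, together with any `λ`, is
exactly one point of `X̂` with `q₁ = q₂`. -/
lemma XHatPoint.existsUnique_diag (k : KPoint t ν R) (lam : R) (hp : IsUnit k.p)
    (hq : ∀ i, IsUnit (k.q - algebraMap ℂ R (t i))) :
    ∃! x : XHatPoint t ν R, x.k₁ = k ∧ x.k₂ = k ∧ x.lam = lam := by
  refine ⟨⟨k, k, lam, fun i => ((k.p + k.p) * lam - k.u i) *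
    Ring.inverse (k.q - algebraMap ℂ R (t i)), by simp, by simp, fun i => ?_, hp⟩,
    ⟨rfl, rfl, rfl⟩, ?_⟩
  · rw [mul_assoc, Ring.inverse_mul_cancel _ (hq i)]
    ring
  · rintro y ⟨h1, h2, h3⟩
    refine XHatPoint.ext h1 h2 h3 (funext fun i => (hq i).mul_right_cancel ?_)
    have h := y.tangent i
    rw [h1, h2, h3] at h
    rw [mul_assoc, Ring.inverse_mul_cancel _ (hq i)]
    linear_combination -h

end Points

/-! ## The matrices of the family -/

section Matrices

variable {t : Fin 4 → ℂ} {ν : Fin 5 → ℂ} {R : Type u} [CommRing R] [Algebra ℂ R]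

namespace XPoint

/-- `a₁ = (p₁ - p₂) / (q₁ - q₂)`. -/
def a1 (x : XPoint t ν R) : R := (x.k₁.p - x.k₂.p) * Ring.inverse (x.k₁.q - x.k₂.q)

/-- `a₀ = -(p₁ q₂ - p₂ q₁) / (q₁ - q₂)`. -/
def a0 (x : XPoint t ν R) : R :=
  -(x.k₁.p * x.k₂.q - x.k₂.p * x.k₁.q) * Ring.inverse (x.k₁.q - x.k₂.q)

/-- `f₁₂`, the polynomial in `z` of degree at most four with leading coefficient `ν₅²` and
`f₁₂(tᵢ) = (ν̂ᵢ² - (a₁ tᵢ + a₀)²) / ((tᵢ - q₁) (tᵢ - q₂))` for the four finite poles. In the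
coordinates of `𝒦₅'` the fraction is `(uᵢ(k₁) - uᵢ(k₂)) / (q₁ - q₂) - a₁²`, which has a meaning
also where `q₁` or `q₂` is a pole. -/
def f12 (x : XPoint t ν R) : R[X] :=
  C (algebraMap ℂ R (ν 4 ^ 2)) * ∏ i, (X - C (algebraMap ℂ R (t i))) +
    ∑ i, C ((x.k₁.u i - x.k₂.u i) * Ring.inverse (x.k₁.q - x.k₂.q) - x.a1 ^ 2) *
      (Lagrange.basis Finset.univ t i).map (algebraMap ℂ R)

/-- The matrix `A⁰_z`. -/
def A0 (x : XPoint t ν R) : Matrix (Fin 2) (Fin 2) R[X] :=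
  !![C x.a1 * X + C x.a0, x.f12;
     (X - C x.k₁.q) * (X - C x.k₂.q), -(C x.a1 * X + C x.a0)]

/-- The matrix `P₁`. -/
def P1 (x : XPoint t ν R) : Matrix (Fin 2) (Fin 2) (Overlap x.k₁.q) :=
  !![1, 0; 0, res0 x.k₁.q (X - C x.k₁.q)]

/-- The matrix `P₂`. -/
def P2 (x : XPoint t ν R) : Matrix (Fin 2) (Fin 2) (Overlap x.k₁.q) :=
  !![1, 0; res0 x.k₁.q (C ((x.k₁.q - x.k₂.q) * Ring.inverse (2 * x.k₁.p))), 1]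

/-- The matrix `P₃`. -/
def P3 (x : XPoint t ν R) : Matrix (Fin 2) (Fin 2) (Overlap x.k₁.q) :=
  !![invZq x.k₁.q, 0; 0, 1]

end XPoint

end Matrices

end HiggsP1

end

open HiggsP1

noncomputable section

namespace HiggsP1

/-! ## Functions on the charts -/

section Charts

variable {R : Type u} [CommRing R] (q : R)

/-! The point is to eliminate the division by `q₁ - q₂`. Over `X` the entry `a₁ z + a₀` is the line
through `(q₁, p₁)` and `(q₂, p₂)`, that is `λ (z - q₁) + p₁`, and `f₁₂` takes the value `μᵢ - λ²` at
`tᵢ`. Both expressions make sense over all of `X̂`. The relations of `X̂` still give `-det A⁰ =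
ν̂ᵢ²` at the finite poles (`XHatPoint.eval_lin_sq_add`), so `A⁰` extends with the prescribed
residues.

Put `s = (q₁ - q₂) / (2 p₁)`. At `q₁` the matrix `A⁰` is upper triangular, and its `p₁`-eigenline is
spanned by `(1, 0)`; after the lower modification the fibre is lower triangular and the eigenline is
spanned by `(1, s)`. The matrix `P₁` is the inclusion of the lower modification, `P₂ P₃` the change
of frame of the upper one. The final conjugate is polynomial because `z - q₂ - 2 s (λ (z - q₁) +
p₁)` is divisible by `z - q₁` (`XHatPoint.X_sub_C_eq`). The quotient `1 - 2 s λ` involves no inverse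
of `q₁ - q₂`, so the modified field also extends. The chart at infinity avoids `q₁`, so its Higgs
matrix never changes.

The resulting transition matrix has rows `(z - q₁, 0)` and `(-s, w / (z - q₁))`. If `s` is
invertible, the corner `-s` serves as a pivot and the bundle is `𝒪 ⊕ 𝒪(-1)`; if `s = 0`, the matrix
is diagonal and the bundle is `𝒪(1) ⊕ 𝒪(-2)`. The section `(1, 0)` at infinity reads `(z - q₁, -s)`
over `U₀`, which gives its zero. -/

lemma isUnit_ww : IsUnit (ww q) :=
  IsUnit.of_mul_eq_one (zz q) (by rw [mul_comm, zz_mul_ww])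

lemma isUnit_res0_sub : IsUnit (res0 q (X - C q)) :=
  IsUnit.of_mul_eq_one _ (zq_mul_invZq q)

lemma resInf_algebraMap (g : R[X]) :
    resInf q (algebraMap R[X] (ChartInf q) g) = eval₂ ((res0 q).comp C) (ww q) g := by
  rw [resInf, IsLocalization.Away.lift_eq, coe_eval₂RingHom]

lemma evalInf_algebraMap (g : R[X]) :
    evalInf q (algebraMap R[X] (ChartInf q) g) = g.eval 0 := by
  rw [evalInf, IsLocalization.Away.lift_eq, coe_evalRingHom]

/-- Reversing coefficients realises `w ^ N g(1/w)` as a polynomial in `w`; this is how the entries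
of the Higgs field are continued to infinity. -/
lemma resInf_reflect {N : ℕ} {g : R[X]} (hg : g.natDegree ≤ N) :
    resInf q (algebraMap R[X] (ChartInf q) (reflect N g)) = ww q ^ N * res0 q g := by
  have hzw := zz_mul_ww q
  -- The instance is chosen so that `⅟(zz q)` unfolds to `ww q`, which the later `change` uses.
  let _ : Invertible (zz q) := ⟨ww q, by rw [mul_comm, hzw], hzw⟩
  have h := eval₂_reflect_mul_pow ((res0 q).comp C) (zz q) N g hg
  have h0 : eval₂ ((res0 q).comp C) (zz q) g = res0 q g := by
    rw [zz, ← hom_eval₂, eval₂_C_X]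
  rw [h0] at h
  change eval₂ ((res0 q).comp C) (ww q) (reflect N g) * zz q ^ N = _ at h
  have hN : zz q ^ N * ww q ^ N = 1 := by rw [← mul_pow, hzw, one_pow]
  rw [resInf_algebraMap]
  linear_combination ww q ^ N * h - eval₂ ((res0 q).comp C) (ww q) (reflect N g) * hN

lemma resInf_one_sub (r : R) :
    resInf q (algebraMap R[X] (ChartInf q) (1 - C r * X)) = ww q * res0 q (X - C r) := by
  rw [resInf_algebraMap, map_sub, ← zz]
  simp only [eval₂_sub, eval₂_mul, eval₂_C, eval₂_X, eval₂_one, RingHom.comp_apply]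
  linear_combination -zz_mul_ww q

lemma isUnit_one_sub : IsUnit (algebraMap R[X] (ChartInf q) (1 - C q * X)) := by
  have h := (IsLocalization.Away.algebraMap_isUnit (S := ChartInf q) (C q * X - 1 : R[X])).neg
  rwa [← map_neg, neg_sub] at h

variable {S : Type u} [CommRing S] (f : R →+* S)

lemma overlapMap_res0 (g : R[X]) : overlapMap q f (res0 q g) = res0 (f q) (g.map f) :=
  IsLocalization.Away.lift_eq _ (isUnit_overlap q f) g

lemma overlapMap_zz : overlapMap q f (zz q) = zz (f q) := by
  rw [zz, overlapMap_res0, map_X, zz]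

/-- Both sides are inverse to `z`, and inverses are unique; the same argument with `z - q` handles
`invZq`. -/
lemma overlapMap_ww : overlapMap q f (ww q) = ww (f q) := by
  have h := congrArg (overlapMap q f) (zz_mul_ww q)
  rw [map_mul, map_one, overlapMap_zz] at h
  linear_combination ww (f q) * h - overlapMap q f (ww q) * zz_mul_ww (f q)

lemma overlapMap_invZq : overlapMap q f (invZq q) = invZq (f q) := by
  have h := congrArg (overlapMap q f) (zq_mul_invZq q)
  rw [map_mul, map_one, overlapMap_res0, Polynomial.map_sub, map_X, map_C] at h
  linear_combination invZq (f q) * h - overlapMap q f (invZq q) * zq_mul_invZq (f q)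

lemma chartInfMap_algebraMap (g : R[X]) :
    chartInfMap q f (algebraMap R[X] (ChartInf q) g) =
      algebraMap S[X] (ChartInf (f q)) (g.map f) := by
  rw [chartInfMap, IsLocalization.Away.lift_eq]
  rfl

end Charts

/-! ## Lines in the fibre and lower modifications -/

section Lines

variable {R : Type u} [CommRing R]

/-- The frame of `(q, l)^low` for the line `l` spanned by `(1, c)`. -/
def lowerFrame (q c : R) : Matrix (Fin 2) (Fin 2) R[X] := !![1, 0; C c, X - C q]

lemma lowerFrame_injective (q c : R) : Function.Injective (fun s => lowerFrame q c *ᵥ s) := by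
  intro s s' h
  have h0 : s 0 = s' 0 := by simpa [lowerFrame, mulVec, dotProduct] using congrFun h 0
  have h1 := congrFun h 1
  simp only [lowerFrame, mulVec, dotProduct, Fin.sum_univ_two, of_apply, cons_val_zero,
    cons_val_one, h0, add_right_inj] at h1
  -- Monic polynomials are non-zero-divisors over any ring, so `R` may be non-reduced.
  have h2 : s 1 = s' 1 := (monic_X_sub_C q).isRegular.left h1
  funext i
  fin_cases i
  · exact h0
  · exact h2

lemma mem_span_line {c : R} {v : Fin 2 → R} :
    v ∈ Submodule.span R {![1, c]} ↔ v 1 = c * v 0 := by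
  rw [Submodule.mem_span_singleton]
  constructor
  · rintro ⟨r, rfl⟩
    simp [mul_comm]
  · intro h
    refine ⟨v 0, funext fun i => ?_⟩
    fin_cases i
    · simp
    · simp [h, mul_comm]

/-- The value at `q` lies on the line exactly when `s₁ - c s₀` has the root `q`, hence is a multiple
of `z - q`; the quotient is the second coordinate in the new frame. -/
lemma range_lowerFrame (q c : R) : Set.range (fun s => lowerFrame q c *ᵥ s) =
    {s | (fun i => (s i).eval q) ∈ Submodule.span R {![1, c]}} := by
  ext s
  rw [Set.mem_ofPred_eq, mem_span_line]
  constructor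
  · rintro ⟨r, rfl⟩
    simp [lowerFrame, mulVec, dotProduct]
  · intro h
    have h' : (s 1 - C c * s 0).IsRoot q := by
      simp [IsRoot, h]
    obtain ⟨g, hg⟩ := dvd_iff_isRoot.mpr h'
    refine ⟨![s 0, g], funext fun i => ?_⟩
    fin_cases i
    · simp [lowerFrame, mulVec, dotProduct]
    · simp [lowerFrame, mulVec, dotProduct, ← hg]

lemma exists_basis_line (c : R) : ∃ B : GL (Fin 2) R,
    Submodule.span R {![1, c]} = Submodule.span R {B.1 *ᵥ ![1, 0]} := by
  refine ⟨⟨!![1, 0; c, 1], !![1, 0; -c, 1], ?_, ?_⟩, ?_⟩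
  · ext i j; fin_cases i <;> fin_cases j <;> simp [Matrix.mul_apply]
  · ext i j; fin_cases i <;> fin_cases j <;> simp [Matrix.mul_apply]
  · congr 2
    funext i
    fin_cases i <;> simp [mulVec, dotProduct]

/-- The kernel of `![0, b; d, e]` is spanned by `(1, c)` if `e` is invertible and `d + e c = 0`,
`b c = 0`. -/
lemma ker_toLin'_eq_span {b d e c : R} (he : IsUnit e) (hd : d + e * c = 0) (hb : b * c = 0) :
    LinearMap.ker (Matrix.toLin' !![0, b; d, e]) = Submodule.span R {![1, c]} := by
  ext v
  rw [mem_span_line, LinearMap.mem_ker, toLin'_apply]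
  constructor
  · intro h
    have h1 := congrFun h 1
    simp only [mulVec, dotProduct, Fin.sum_univ_two, of_apply, cons_val_zero,
      cons_val_one, Pi.zero_apply] at h1
    refine he.mul_left_cancel ?_
    linear_combination h1 - v 0 * hd
  · intro h
    funext i
    fin_cases i
    · simp [mulVec, dotProduct, h]
      linear_combination v 0 * hb
    · simp [mulVec, dotProduct, h]
      linear_combination v 0 * hd

end Lines

namespace HiggsPair

variable {R : Type u} [CommRing R] {q : R}

/-- A lower modification along the line spanned by `(1, c)` whose inclusion is given by
`lowerFrame q c` over `U₀` and by the identity over `U_∞^q`. -/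
lemma isLowerModification_of_lowerFrame {E E' : HiggsPair R q} {c : R}
    (hT : (lowerFrame q c).map (res0 q) * E'.T = E.T)
    (hΦ : E.Φ₀ * lowerFrame q c = lowerFrame q c * E'.Φ₀) (hinf : E'.Φinf = E.Φinf) :
    E.IsLowerModification E' (Submodule.span R {![1, c]}) := by
  refine ⟨exists_basis_line c, lowerFrame q c, 1, lowerFrame_injective q c, range_lowerFrame q c,
    ?_, hΦ, ?_⟩
  · rw [hT, Units.val_one, Matrix.map_one _ (map_zero _) (map_one _), mul_one]
  · rw [hinf, Units.val_one, mul_one, one_mul]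

end HiggsPair

/-- The transition matrix after the lower and the upper modification of `𝒪 ⊕ 𝒪(-1)` at `z = q`, the
second one along the line spanned by `(1, c)`. -/
def modificationT {R : Type u} [CommRing R] (q c : R) : Matrix (Fin 2) (Fin 2) (Overlap q) :=
  !![res0 q (X - C q), 0; -res0 q (C c), ww q * invZq q]

section BaseChange

variable {R : Type u} [CommRing R] (q : R) {S : Type u} [CommRing S] (f : R →+* S)

lemma map_splitT (k : ℕ) : (splitT q k).map (overlapMap q f) = splitT (f q) k := by
  ext i j
  fin_cases i <;> fin_cases j <;> simp [splitT, overlapMap_ww, overlapMap_zz]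

lemma map_modificationT (c : R) :
    (modificationT q c).map (overlapMap q f) = modificationT (f q) (f c) := by
  have h := overlapMap_res0 q f (X - C q)
  rw [Polynomial.map_sub, map_X, map_C] at h
  ext i j
  fin_cases i <;> fin_cases j <;>
    simp only [modificationT, map_apply, of_apply, cons_val', cons_val_zero, cons_val_one,
      cons_val_fin_one, Fin.zero_eta, Fin.mk_one, map_neg, map_mul, map_zero, h, overlapMap_res0,
      overlapMap_ww, overlapMap_invZq, map_C]

end BaseChange

/-! ## The entries of the Higgs fields over `X̂` -/

namespace XHatPoint

section Entries

variable {t : Fin 4 → ℂ} {ν : Fin 5 → ℂ} {R : Type u} [CommRing R] [Algebra ℂ R]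
  (x : XHatPoint t ν R)

/-- The linear polynomial `λ (z - q₁) + p₁`, which is `a₁ z + a₀` over `X`. -/
def lin : R[X] := C x.lam * X + C (x.k₁.p - x.lam * x.k₁.q)

/-- The extension of `f₁₂` to `X̂`. -/
def f12 : R[X] :=
  C (algebraMap ℂ R (ν 4 ^ 2)) * ∏ i, (X - C (algebraMap ℂ R (t i))) +
    ∑ i, C (x.mu i - x.lam ^ 2) * (Lagrange.basis Finset.univ t i).map (algebraMap ℂ R)

/-- The slope `(q₁ - q₂) / (2 p₁)` of the second eigenline. -/
def slope : R := (x.k₁.q - x.k₂.q) * Ring.inverse (2 * x.k₁.p)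

lemma isUnit_two_mul_p : IsUnit (2 * x.k₁.p) := by
  have h : IsUnit (algebraMap ℂ R 2) := (IsUnit.mk0 (2 : ℂ) two_ne_zero).map _
  rw [map_ofNat] at h
  exact h.mul x.isUnit_p

lemma slope_mul : x.slope * (2 * x.k₁.p) = x.k₁.q - x.k₂.q := by
  rw [slope, mul_assoc, Ring.inverse_mul_cancel _ x.isUnit_two_mul_p, mul_one]

lemma isUnit_slope (h : IsUnit (x.k₁.q - x.k₂.q)) : IsUnit x.slope :=
  h.mul x.isUnit_two_mul_p.ringInverse

lemma slope_eq_zero (h : x.k₁.q = x.k₂.q) : x.slope = 0 := by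
  rw [slope, h, sub_self, zero_mul]

lemma natDegree_lin_le : x.lin.natDegree ≤ 1 := natDegree_linear_le

lemma prod_X_sub_C_eq_map : ∏ i, (X - C (algebraMap ℂ R (t i))) =
    (∏ i, (X - C (t i))).map (algebraMap ℂ R) := by
  simp [Polynomial.map_prod]

lemma natDegree_basis_eq (ht : Function.Injective t) (i : Fin 4) :
    (Lagrange.basis Finset.univ t i).natDegree = 3 := by
  rw [Lagrange.natDegree_basis ht.injOn (Finset.mem_univ i)]
  rfl

lemma natDegree_f12_le (ht : Function.Injective t) : x.f12.natDegree ≤ 4 := by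
  have hprod : (∏ i, (X - C (t i))).natDegree = 4 := by
    rw [natDegree_finsetProd_X_sub_C_eq_card]; rfl
  refine natDegree_add_le_of_degree_le ?_ (natDegree_sum_le_of_forall_le _ _ fun i _ => ?_)
  · rw [prod_X_sub_C_eq_map]
    exact (natDegree_C_mul_le _ _).trans (natDegree_map_le.trans hprod.le)
  · refine (natDegree_C_mul_le _ _).trans (natDegree_map_le.trans ?_)
    rw [natDegree_basis_eq ht]
    norm_num

lemma coeff_f12 (ht : Function.Injective t) : x.f12.coeff 4 = algebraMap ℂ R (ν 4 ^ 2) := by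
  have hprod : (∏ i, (X - C (t i))).coeff 4 = 1 := by
    have h := (monic_prod_X_sub_C t Finset.univ).coeff_natDegree
    rwa [natDegree_finsetProd_X_sub_C_eq_card] at h
  have hb : ∀ i, (Lagrange.basis Finset.univ t i).coeff 4 = 0 := fun i =>
    coeff_eq_zero_of_natDegree_lt (by rw [natDegree_basis_eq ht]; norm_num)
  rw [f12, coeff_add, prod_X_sub_C_eq_map, coeff_C_mul, coeff_map, hprod, finsetSum_coeff]
  simp only [coeff_C_mul, coeff_map, hb, map_zero, map_one, mul_zero, mul_one,
    Finset.sum_const_zero, add_zero]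

lemma eval_f12 (ht : Function.Injective t) (i : Fin 4) :
    x.f12.eval (algebraMap ℂ R (t i)) = x.mu i - x.lam ^ 2 := by
  rw [f12, eval_add, eval_mul, eval_prod, Finset.prod_eq_zero (Finset.mem_univ i) (by simp),
    mul_zero, zero_add, eval_finsetSum, Finset.sum_eq_single i]
  · rw [eval_mul, eval_C, eval_map_algebraMap, aeval_algebraMap_apply, coe_aeval_eq_eval,
      Lagrange.eval_basis_self ht.injOn (Finset.mem_univ i), map_one, mul_one]
  · intro j _ hj
    rw [eval_mul, eval_C, eval_map_algebraMap, aeval_algebraMap_apply, coe_aeval_eq_eval,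
      Lagrange.eval_basis_of_ne hj (Finset.mem_univ i), map_zero, mul_zero]
  · simp

/-- `-det A⁰_z` takes the value `ν̂ᵢ²` at `tᵢ`. -/
lemma eval_lin_sq_add (ht : Function.Injective t) (i : Fin 4) :
    x.lin.eval (algebraMap ℂ R (t i)) ^ 2 + x.f12.eval (algebraMap ℂ R (t i)) *
      ((algebraMap ℂ R (t i) - x.k₁.q) * (algebraMap ℂ R (t i) - x.k₂.q)) =
      algebraMap ℂ R (nuHat t ν i) ^ 2 := by
  rw [eval_f12 x ht, lin, eval_add, eval_mul, eval_C, eval_C, eval_X]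
  -- Using `rel`, the left side becomes `p₁² + (tᵢ - q₁) ((p₁ + p₂) λ + μᵢ (tᵢ - q₂))`. By `tangent`
  -- and `rel_u` the last factor equals `u₁ᵢ`, and the equation of `𝒦₅'` at `k₁` finishes.
  linear_combination x.k₁.rel i + (algebraMap ℂ R (t i) - x.k₁.q) *
    (-x.lam * x.rel + x.tangent i + x.rel_u i)

/-- At `z = q₁` the difference `z - q₂ - 2 s lin` is `q₁ - q₂ - 2 s p₁ = 0`, by the choice of the
slope `s`. Being linear in `z`, it is its leading coefficient `1 - 2 s λ` times `z - q₁`. This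
cancels the only pole that the two modifications could create. -/
lemma X_sub_C_eq : X - C x.k₂.q =
    (1 - 2 * C x.slope * C x.lam) * (X - C x.k₁.q) + 2 * C x.slope * x.lin := by
  have h := congrArg (C : R → R[X]) x.slope_mul
  simp only [map_mul, map_sub, map_ofNat] at h
  rw [lin, map_sub, map_mul]
  linear_combination -h

variable {S : Type u} [CommRing S] [Algebra ℂ S] (f : R →ₐ[ℂ] S)

lemma map_lin : x.lin.map (f : R →+* S) = (x.map f).lin := by
  simp [lin, XHatPoint.map, KPoint.map]

lemma map_f12 : x.f12.map (f : R →+* S) = (x.map f).f12 := by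
  simp [f12, XHatPoint.map, Polynomial.map_prod, Polynomial.map_sum, Polynomial.map_map]

/-- The slope is characterised by `s · 2 p₁ = q₁ - q₂` with `2 p₁` invertible, an equation preserved
by `f`; this avoids transporting `Ring.inverse`. -/
lemma map_slope : f x.slope = (x.map f).slope := by
  have h1 := congrArg f x.slope_mul
  have h2 := (x.map f).slope_mul
  rw [map_mul, map_mul, map_sub, map_ofNat] at h1
  exact (x.map f).isUnit_two_mul_p.mul_right_cancel (h1.trans h2.symm)

end Entries

/-! ## The Higgs fields over `X̂` -/

section Families

variable {t : Fin 4 → ℂ} {ν : Fin 5 → ℂ} {R : Type u} [CommRing R] [Algebra ℂ R]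
  (x : XHatPoint t ν R)

/-- The matrix `A⁰_z` over `X̂`. -/
def A0 : Matrix (Fin 2) (Fin 2) R[X] :=
  !![x.lin, x.f12; (X - C x.k₁.q) * (X - C x.k₂.q), -x.lin]

/-- The matrix `R₀⁻¹ A⁰_z R₀` with respect to the generator of `L` at infinity. -/
def Ainf : Matrix (Fin 2) (Fin 2) R[X] :=
  !![-(X ^ 2 * reflect 1 x.lin), -reflect 4 x.f12;
     -((1 - C x.k₁.q * X) * (1 - C x.k₂.q * X)), X ^ 2 * reflect 1 x.lin]

/-- The Higgs field over `U₀` after the lower modification. -/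
def A1 : Matrix (Fin 2) (Fin 2) R[X] :=
  !![x.lin, x.f12 * (X - C x.k₁.q); X - C x.k₂.q, -x.lin]

/-- The Higgs field over `U₀` after both modifications. -/
def A2 : Matrix (Fin 2) (Fin 2) R[X] :=
  !![x.lin + C x.slope * x.f12 * (X - C x.k₁.q), x.f12 * (X - C x.k₁.q) ^ 2;
     1 - 2 * C x.slope * C x.lam - C x.slope ^ 2 * x.f12,
     -(x.lin + C x.slope * x.f12 * (X - C x.k₁.q))]

/-- The powers of `w` combine the factor `-w³` from `ω_z = -w³ ω_w` with conjugation by `diag(1,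
w)`. The bounds `deg lin ≤ 1` and `deg f₁₂ ≤ 4` make the reflected entries regular at infinity. All
three Higgs pairs are glued with this matrix. -/
lemma map_Ainf (ht : Function.Injective t) :
    (x.Ainf.map (algebraMap R[X] (ChartInf x.k₁.q))).map (resInf x.k₁.q) =
      !![-(ww x.k₁.q ^ 3 * res0 x.k₁.q x.lin), -(ww x.k₁.q ^ 4 * res0 x.k₁.q x.f12);
         -(ww x.k₁.q ^ 2 * (res0 x.k₁.q (X - C x.k₁.q) * res0 x.k₁.q (X - C x.k₂.q))),
         ww x.k₁.q ^ 3 * res0 x.k₁.q x.lin] := by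
  have h1 := resInf_reflect x.k₁.q x.natDegree_lin_le
  have h2 := resInf_reflect x.k₁.q (x.natDegree_f12_le ht)
  have h3 := resInf_one_sub x.k₁.q x.k₁.q
  have h4 := resInf_one_sub x.k₁.q x.k₂.q
  have h5 : resInf x.k₁.q (algebraMap R[X] (ChartInf x.k₁.q) X) = ww x.k₁.q := by
    rw [resInf_algebraMap, eval₂_X]
  ext i j
  fin_cases i <;> fin_cases j <;>
    simp only [Ainf, map_apply, of_apply, cons_val', cons_val_zero, cons_val_one, cons_val_fin_one,
      Fin.zero_eta, Fin.mk_one, map_neg, map_mul, map_pow, h1, h2, h3, h4, h5] <;> ring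

/-- The bundle `𝒪 ⊕ 𝒪(-1)` with the Higgs field `A⁰_z ⊗ ω_z`. -/
def pair0 (ht : Function.Injective t) : HiggsPair R x.k₁.q where
  T := splitT x.k₁.q 0
  isUnit_det_T := by simpa [splitT] using isUnit_ww x.k₁.q
  Φ₀ := x.A0
  Φinf := x.Ainf.map (algebraMap R[X] (ChartInf x.k₁.q))
  glue := by
    rw [map_Ainf x ht]
    ext i j
    fin_cases i <;> fin_cases j <;>
      simp [splitT, A0, Matrix.mul_apply] <;> ring

/-- The lower modification of `pair0` at `q₁`. -/
def pair1 (ht : Function.Injective t) : HiggsPair R x.k₁.q where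
  T := !![1, 0; 0, ww x.k₁.q * invZq x.k₁.q]
  isUnit_det_T := by
    have h := (isUnit_ww x.k₁.q).mul (IsUnit.of_mul_eq_one_right _ (zq_mul_invZq x.k₁.q))
    simpa using h
  Φ₀ := x.A1
  Φinf := x.Ainf.map (algebraMap R[X] (ChartInf x.k₁.q))
  glue := by
    have h := zq_mul_invZq x.k₁.q
    rw [map_Ainf x ht]
    ext i j
    fin_cases i <;> fin_cases j <;>
      simp only [A1, Matrix.mul_apply, Fin.sum_univ_two, map_apply, Matrix.smul_apply,
        of_apply, cons_val', cons_val_zero, cons_val_one, cons_val_fin_one, Fin.zero_eta, Fin.mk_one, map_neg, map_mul,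
        smul_eq_mul]
    · ring
    · linear_combination (ww x.k₁.q ^ 4 * res0 x.k₁.q x.f12) * h
    · linear_combination (-ww x.k₁.q ^ 3 * res0 x.k₁.q (X - C x.k₂.q)) * h
    · ring

/-- The bundle obtained from `pair0` by both modifications at `q₁`. -/
def pair2 (ht : Function.Injective t) : HiggsPair R x.k₁.q where
  T := modificationT x.k₁.q x.slope
  isUnit_det_T := by
    have h := (isUnit_res0_sub x.k₁.q).mul
      ((isUnit_ww x.k₁.q).mul (IsUnit.of_mul_eq_one_right _ (zq_mul_invZq x.k₁.q)))
    rwa [modificationT, det_fin_two_of, zero_mul, sub_zero]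
  Φ₀ := x.A2
  Φinf := x.Ainf.map (algebraMap R[X] (ChartInf x.k₁.q))
  glue := by
    have h := zq_mul_invZq x.k₁.q
    -- Expanding `z - q₂` in this way exposes the multiple of `z - q₁` that cancels against `1 / (z
    -- - q₁)` in the transition matrix.
    have hq : res0 x.k₁.q (X - C x.k₂.q) =
        (1 - 2 * res0 x.k₁.q (C x.slope) * res0 x.k₁.q (C x.lam)) * res0 x.k₁.q (X - C x.k₁.q) +
          2 * res0 x.k₁.q (C x.slope) * res0 x.k₁.q x.lin := by
      rw [x.X_sub_C_eq]
      simp only [map_add, map_mul, map_sub, map_one, map_ofNat]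
    rw [map_Ainf x ht, hq]
    rw [map_sub] at h
    ext i j
    fin_cases i <;> fin_cases j <;>
      simp only [A2, modificationT, Matrix.mul_apply, Fin.sum_univ_two, map_apply,
        Matrix.smul_apply, of_apply, cons_val', cons_val_zero, cons_val_one,
        cons_val_fin_one, Fin.zero_eta, Fin.mk_one, map_neg, map_mul, map_add, map_sub, map_pow, map_one, map_ofNat, smul_eq_mul]
    · ring
    · linear_combination
        (ww x.k₁.q ^ 4 * res0 x.k₁.q x.f12 * (res0 x.k₁.q X - res0 x.k₁.q (C x.k₁.q))) * h
    · linear_combination (-ww x.k₁.q ^ 3 * ((1 - 2 * res0 x.k₁.q (C x.slope) *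
        res0 x.k₁.q (C x.lam)) * (res0 x.k₁.q X - res0 x.k₁.q (C x.k₁.q)) +
          2 * res0 x.k₁.q (C x.slope) * res0 x.k₁.q x.lin)) * h
    · linear_combination (-ww x.k₁.q ^ 4 * res0 x.k₁.q (C x.slope) * res0 x.k₁.q x.f12) * h

end Families

end XHatPoint

/-! ### Eigenvalues of the residues, and the two families with their sections -/

lemma charpoly_of_trace_eq_zero {R : Type u} [CommRing R] {M : Matrix (Fin 2) (Fin 2) R} {n : R}
    (htr : M.trace = 0) (hdet : M.det = -n ^ 2) : M.charpoly = (X - C n) * (X + C n) := by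
  nontriviality R
  rw [charpoly_fin_two, htr, hdet, map_zero, map_neg, map_pow]
  ring

/-- Residues with eigenvalues `±νᵢ` at the finite poles, in terms of the determinant. -/
lemma HiggsPair.residue_charpoly {R : Type u} [CommRing R] [Algebra ℂ R] {q : R}
    {t : Fin 4 → ℂ} (ν : Fin 5 → ℂ) (ht : Function.Injective t) {E : HiggsPair R q}
    (htr : E.Φ₀.trace = 0) (i : Fin 4)
    (hdet : E.Φ₀.det.eval (algebraMap ℂ R (t i)) = -algebraMap ℂ R (nuHat t ν i) ^ 2) :
    (E.residue t i).charpoly =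
      (X - C (algebraMap ℂ R (ν i.castSucc))) * (X + C (algebraMap ℂ R (ν i.castSucc))) := by
  have hprod : ∏ j ∈ Finset.univ.erase i, (t i - t j) ≠ 0 :=
    Finset.prod_ne_zero_iff.mpr fun j hj =>
      sub_ne_zero.mpr fun h => Finset.ne_of_mem_erase hj (ht h).symm
  apply charpoly_of_trace_eq_zero
  · have h := congrArg (eval (algebraMap ℂ R (t i))) htr
    rw [trace_fin_two, eval_add, eval_zero] at h
    simp only [HiggsPair.residue, trace_fin_two, Matrix.smul_apply, map_apply, smul_eq_mul]
    rw [← mul_add, h, mul_zero]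
  · rw [det_fin_two, eval_sub, eval_mul, eval_mul] at hdet
    simp only [HiggsPair.residue, det_smul, det_fin_two, map_apply, Fintype.card_fin]
    -- The normalising factor of the residue is exactly the inverse of the product in `ν̂ᵢ`, leaving
    -- `νᵢ`.
    rw [hdet, mul_neg, ← mul_pow, ← map_mul, nuHat, mul_comm, mul_assoc, mul_inv_cancel₀ hprod,
      mul_one]

/-- The pair `E ⊗ 𝒪(-q)`. -/
def HiggsPair.untwist {R : Type u} [CommRing R] {q : R} (E : HiggsPair R q) : HiggsPair R q where
  T := invZq q • E.T
  isUnit_det_T := by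
    rw [det_smul]
    exact ((IsUnit.of_mul_eq_one_right _ (zq_mul_invZq q)).pow _).mul E.isUnit_det_T
  Φ₀ := E.Φ₀
  Φinf := E.Φinf
  glue := by rw [smul_mul_assoc, E.glue, mul_smul_comm, smul_comm]

lemma HiggsPair.untwist_isTwist {R : Type u} [CommRing R] {q : R} (E : HiggsPair R q) :
    E.untwist.IsTwist E :=
  ⟨by rw [untwist, smul_smul, zq_mul_invZq, one_smul], rfl, rfl⟩

namespace XHatPoint

section Families

variable {t : Fin 4 → ℂ} {ν : Fin 5 → ℂ} {R : Type u} [CommRing R] [Algebra ℂ R]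
  (x : XHatPoint t ν R)

lemma trace_A0 : x.A0.trace = 0 := by simp [A0, trace_fin_two]

lemma trace_A2 : x.A2.trace = 0 := by
  rw [trace_fin_two]
  exact add_neg_cancel _

lemma trace_Ainf : (x.Ainf.map (algebraMap R[X] (ChartInf x.k₁.q))).trace = 0 := by
  simp [Ainf, trace_fin_two]

/-- The two fields are conjugate away from `q₁`; as a polynomial identity this reduces to
`X_sub_C_eq`. The residue conditions thus pass from one family to the other, even when `q₁` is a
pole. -/
lemma det_A2 : x.A2.det = x.A0.det := by
  simp only [A2, A0, det_fin_two_of]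
  linear_combination x.f12 * (X - C x.k₁.q) * x.X_sub_C_eq

lemma eval_det_A0 (ht : Function.Injective t) (i : Fin 4) :
    x.A0.det.eval (algebraMap ℂ R (t i)) = -algebraMap ℂ R (nuHat t ν i) ^ 2 := by
  rw [← x.eval_lin_sq_add ht i, A0, det_fin_two_of]
  simp only [eval_sub, eval_mul, eval_neg, eval_X, eval_C]
  ring

lemma charpoly_evalInf (ht : Function.Injective t) :
    ((x.Ainf.map (algebraMap R[X] (ChartInf x.k₁.q))).map (evalInf x.k₁.q)).charpoly =
      (X - C (algebraMap ℂ R (ν 4))) * (X + C (algebraMap ℂ R (ν 4))) := by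
  have hf : (reflect 4 x.f12).eval 0 = algebraMap ℂ R (ν 4) ^ 2 := by
    -- The value at `w = 0` of the reflected polynomial is the coefficient of `z⁴` in `f₁₂`, which
    -- is `ν₅²`.
    rw [← coeff_zero_eq_eval_zero, coeff_reflect, ← map_pow, ← coeff_f12 x ht]
    rfl
  apply charpoly_of_trace_eq_zero
  · simp [trace_fin_two, Ainf]
  · rw [det_fin_two]
    simp only [Ainf, map_apply, of_apply, cons_val', cons_val_zero, cons_val_one,
      cons_val_fin_one, evalInf_algebraMap, eval_neg, eval_mul, eval_pow, eval_sub, eval_X,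
      eval_one, eval_C, hf]
    ring

/-- The family `(𝒪 ⊕ 𝒪(-1), A⁰_z ⊗ ω_z)` over `X̂`, with the section `(1, 0)`. -/
def family0 (ht : Function.Injective t) : ParabolicHiggs t ν R x.k₁.q where
  toHiggsPair := x.pair0 ht
  φ₀ := 1
  φinf := 1
  glue_φ := by simp [pair0, splitT]
  trace_zero := ⟨x.trace_A0, x.trace_Ainf⟩
  residue_eigenvalues i :=
    HiggsPair.residue_charpoly ν ht (E := x.pair0 ht) x.trace_A0 i (x.eval_det_A0 ht i)
  residueInf_eigenvalues := x.charpoly_evalInf ht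
  σ₀ := ![1, 0]
  σinf := ![1, 0]
  glue_σ := by
    funext i
    fin_cases i <;> simp [pair0, splitT, mulVec, dotProduct]
  σ_ne_zero m hm := by
    have := Ideal.Quotient.nontrivial_iff.mpr hm.ne_top
    exact ⟨0, by simp⟩

/-- The family over `X̂` obtained from `family0` by both modifications, with the section
`(z - q₁, -(q₁ - q₂) / (2 p₁))`. -/
def family (ht : Function.Injective t) : ParabolicHiggs t ν R x.k₁.q where
  toHiggsPair := x.pair2 ht
  φ₀ := 1
  φinf := 1
  glue_φ := by
    simp only [pair2, modificationT, det_fin_two_of, Units.val_one, map_one, mul_one]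
    linear_combination ww x.k₁.q * zq_mul_invZq x.k₁.q
  trace_zero := ⟨x.trace_A2, x.trace_Ainf⟩
  residue_eigenvalues i :=
    HiggsPair.residue_charpoly ν ht (E := x.pair2 ht) x.trace_A2 i
      ((congrArg _ x.det_A2).trans (x.eval_det_A0 ht i))
  residueInf_eigenvalues := x.charpoly_evalInf ht
  σ₀ := ![X - C x.k₁.q, -C x.slope]
  σinf := ![1, 0]
  glue_σ := by
    funext i
    fin_cases i <;> simp [pair2, modificationT, mulVec, dotProduct]
  σ_ne_zero m hm := by
    have := Ideal.Quotient.nontrivial_iff.mpr hm.ne_top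
    refine ⟨0, ?_⟩
    simpa using X_sub_C_ne_zero (Ideal.Quotient.mk m x.k₁.q)

/-! ## Base change -/

section BaseChange

variable {S : Type u} [CommRing S] [Algebra ℂ S] (f : R →ₐ[ℂ] S)

lemma map_A0 : (x.map f).A0 = x.A0.map (Polynomial.map (f : R →+* S)) := by
  ext1 i j
  fin_cases i <;> fin_cases j <;> simp [A0, ← map_lin, ← map_f12]
  rfl

lemma map_A2 : (x.map f).A2 = x.A2.map (Polynomial.map (f : R →+* S)) := by
  ext1 i j
  fin_cases i <;> fin_cases j <;>
    simp [A2, ← map_lin, ← map_f12, ← map_slope] <;> rfl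

lemma map_map_Ainf : (x.map f).Ainf.map (algebraMap S[X] (ChartInf (f x.k₁.q))) =
    (x.Ainf.map (algebraMap R[X] (ChartInf x.k₁.q))).map (chartInfMap x.k₁.q (f : R →+* S)) := by
  have h : (x.map f).Ainf = x.Ainf.map (Polynomial.map (f : R →+* S)) := by
    ext1 i j
    fin_cases i <;> fin_cases j <;>
      simp [Ainf, ← map_lin, ← map_f12, reflect_map]
    rfl
  rw [h]
  ext1 i j
  exact (chartInfMap_algebraMap _ _ _).symm

lemma family0_isBaseChange (ht : Function.Injective t) :
    (x.family0 ht).IsBaseChange (f : R →+* S) ((x.map f).family0 ht) where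
  T := (map_splitT x.k₁.q (f : R →+* S) 0).symm
  Φ₀ := x.map_A0 f
  Φinf := x.map_map_Ainf f
  φ₀ := by simp [family0]
  φinf := (map_one (chartInfMap x.k₁.q (f : R →+* S))).symm
  σ₀ i := by fin_cases i <;> simp [family0]
  σinf i := by
    fin_cases i
    · exact (map_one (chartInfMap x.k₁.q (f : R →+* S))).symm
    · exact (map_zero (chartInfMap x.k₁.q (f : R →+* S))).symm

lemma family_isBaseChange (ht : Function.Injective t) :
    (x.family ht).IsBaseChange (f : R →+* S) ((x.map f).family ht) where
  T := (congrArg (modificationT (f x.k₁.q)) (x.map_slope f)).symm.trans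
    (map_modificationT x.k₁.q (f : R →+* S) x.slope).symm
  Φ₀ := x.map_A2 f
  Φinf := x.map_map_Ainf f
  φ₀ := by simp [family]
  φinf := (map_one (chartInfMap x.k₁.q (f : R →+* S))).symm
  σ₀ i := by
    fin_cases i <;> simp [family, ← map_slope]
    rfl
  σinf i := by
    fin_cases i
    · exact (map_one (chartInfMap x.k₁.q (f : R →+* S))).symm
    · exact (map_zero (chartInfMap x.k₁.q (f : R →+* S))).symm

end BaseChange

/-! ## The modifications -/

lemma eigenspaceAt_pair0 (ht : Function.Injective t) :
    (x.pair0 ht).eigenspaceAt x.k₁.p = Submodule.span R {![1, 0]} := by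
  have h : (x.pair0 ht).fiberAt - x.k₁.p • (1 : Matrix (Fin 2) (Fin 2) R) =
      !![0, x.f12.eval x.k₁.q; 0, -(2 * x.k₁.p)] := by
    ext i j
    fin_cases i <;> fin_cases j <;> simp [HiggsPair.fiberAt, pair0, A0, lin]
    ring
  rw [HiggsPair.eigenspaceAt, h]
  exact ker_toLin'_eq_span x.isUnit_two_mul_p.neg (by simp) (by simp)

/-- The lower modification multiplies the upper right entry by `z - q₁`, so the fibre at `q₁`
becomes lower triangular; the eigenvector equation `q₁ - q₂ = 2 p₁ c` forces `c` to be the slope. -/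
lemma eigenspaceAt_pair1 (ht : Function.Injective t) :
    (x.pair1 ht).eigenspaceAt x.k₁.p = Submodule.span R {![1, x.slope]} := by
  have h : (x.pair1 ht).fiberAt - x.k₁.p • (1 : Matrix (Fin 2) (Fin 2) R) =
      !![0, 0; x.k₁.q - x.k₂.q, -(2 * x.k₁.p)] := by
    ext i j
    fin_cases i <;> fin_cases j <;> simp [HiggsPair.fiberAt, pair1, A1, lin]
    ring
  rw [HiggsPair.eigenspaceAt, h]
  exact ker_toLin'_eq_span x.isUnit_two_mul_p.neg (by linear_combination -x.slope_mul) (by simp)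

lemma isLowerModification_pair1 (ht : Function.Injective t) :
    (x.pair0 ht).IsLowerModification (x.pair1 ht) ((x.pair0 ht).eigenspaceAt x.k₁.p) := by
  rw [eigenspaceAt_pair0]
  refine HiggsPair.isLowerModification_of_lowerFrame ?_ ?_ rfl
  · have h := zq_mul_invZq x.k₁.q
    rw [map_sub] at h
    ext i j
    fin_cases i <;> fin_cases j <;> simp [lowerFrame, pair0, pair1, splitT, Matrix.mul_apply]
    linear_combination ww x.k₁.q * h
  · ext1 i j
    fin_cases i <;> fin_cases j <;> simp [lowerFrame, pair0, pair1, A0, A1, Matrix.mul_apply]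
    ring

lemma isUpperModification_pair2 (ht : Function.Injective t) :
    (x.pair1 ht).IsUpperModification (x.pair2 ht) ((x.pair1 ht).eigenspaceAt x.k₁.p) := by
  -- The intermediate lower modification is recovered from the final bundle by tensoring with
  -- `𝒪(-q₁)`.
  refine ⟨(x.pair2 ht).untwist, ?_, (x.pair2 ht).untwist_isTwist⟩
  rw [eigenspaceAt_pair1]
  refine HiggsPair.isLowerModification_of_lowerFrame ?_ ?_ rfl
  · have h := zq_mul_invZq x.k₁.q
    rw [map_sub] at h
    ext i j
    fin_cases i <;> fin_cases j <;>
      simp [lowerFrame, HiggsPair.untwist, pair1, pair2, modificationT, Matrix.mul_apply]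
    · linear_combination h
    · ring
    · linear_combination ww x.k₁.q * invZq x.k₁.q * h
  · ext1 i j
    fin_cases i <;> fin_cases j <;>
      simp [lowerFrame, HiggsPair.untwist, pair1, pair2, A1, A2, Matrix.mul_apply]
    · ring
    · ring
    · linear_combination x.X_sub_C_eq
    · ring

end Families

end XHatPoint

/-! ## The underlying bundles -/

section BundleType

variable {R : Type u} [CommRing R] (q : R)

/-- Gaussian elimination with pivot `-c`: adding `c⁻¹ w² / (1 - q w)` times the first column to the
second, an operation regular at infinity, removes `w / (z - q)` and leaves `c⁻¹ w` above it. The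
factor `G₀` is then read off. -/
lemma exists_modificationT_eq_of_isUnit {c : R} (hc : IsUnit c) :
    ∃ (G₀ : GL (Fin 2) R[X]) (Ginf : GL (Fin 2) (ChartInf q)),
      modificationT q c * Ginf.1.map (resInf q) = G₀.1.map (res0 q) * splitT q 0 := by
  obtain ⟨c, rfl⟩ := hc
  obtain ⟨v, hv⟩ := isUnit_one_sub q
  have hd : IsUnit (!![X - C q, C (↑c⁻¹ : R); -C (c : R), 0] : Matrix (Fin 2) (Fin 2) R[X]).det := by
    rw [det_fin_two_of, mul_zero, mul_neg, zero_sub, neg_neg, ← C_mul, Units.inv_mul, C_1]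
    exact isUnit_one
  have hdinf : IsUnit (!![1, algebraMap R[X] (ChartInf q) (C (↑c⁻¹ : R) * X ^ 2) *
      (↑v⁻¹ : ChartInf q); 0, 1] : Matrix (Fin 2) (Fin 2) (ChartInf q)).det := by
    simp
  refine ⟨GeneralLinearGroup.mk'' _ hd, GeneralLinearGroup.mk'' _ hdinf, ?_⟩
  have h := zq_mul_invZq q
  have hcc : res0 q (C (c : R)) * res0 q (C (↑c⁻¹ : R)) = 1 := by
    rw [← map_mul, ← C_mul, Units.mul_inv, C_1, map_one]
  have hX : resInf q (algebraMap R[X] (ChartInf q) (C (↑c⁻¹ : R) * X ^ 2)) =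
      res0 q (C (↑c⁻¹ : R)) * ww q ^ 2 := by
    rw [resInf_algebraMap, eval₂_mul, eval₂_C, eval₂_pow, eval₂_X, RingHom.comp_apply]
  -- Since `1 - q w = w (z - q)`, the function `w / (1 - q w)` is `1 / (z - q)` on the overlap.
  have hvi : ww q * resInf q (↑v⁻¹ : ChartInf q) = invZq q := by
    have h1 : resInf q (v : ChartInf q) * resInf q (↑v⁻¹ : ChartInf q) = 1 := by
      rw [← map_mul, Units.mul_inv, map_one]
    rw [hv, resInf_one_sub] at h1
    linear_combination invZq q * h1 - ww q * resInf q (↑v⁻¹ : ChartInf q) * h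
  change modificationT q c * (!![1, _; 0, 1] : Matrix (Fin 2) (Fin 2) (ChartInf q)).map (resInf q) =
    (!![X - C q, C (↑c⁻¹ : R); -C (c : R), 0] : Matrix (Fin 2) (Fin 2) R[X]).map (res0 q) * _
  ext i j
  fin_cases i <;> fin_cases j <;>
    simp only [modificationT, splitT, Matrix.mul_apply, Fin.sum_univ_two, map_apply, of_apply,
      cons_val', cons_val_zero, cons_val_one, cons_val_fin_one, Fin.zero_eta, Fin.mk_one, map_neg,
      map_one, map_zero, map_mul (resInf q), hX]
  · ring
  · linear_combination res0 q (C (↑c⁻¹ : R)) * ww q * h +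
      res0 q (C (↑c⁻¹ : R)) * ww q * res0 q (X - C q) * hvi
  · ring
  · linear_combination -res0 q (C (c : R)) * res0 q (C (↑c⁻¹ : R)) * ww q * hvi -
      ww q * invZq q * hcc

/-- The matrix is already diagonal, and the unit `1 - q w = w (z - q)` at infinity turns `z - q`
into `z` and `w / (z - q)` into `w²`. -/
lemma exists_modificationT_zero_eq :
    ∃ (G₀ : GL (Fin 2) R[X]) (Ginf : GL (Fin 2) (ChartInf q)),
      modificationT q 0 * Ginf.1.map (resInf q) = G₀.1.map (res0 q) * splitT q 1 := by
  obtain ⟨v, hv⟩ := isUnit_one_sub q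
  have hdinf : IsUnit (!![(↑v⁻¹ : ChartInf q), 0; 0, (v : ChartInf q)] :
      Matrix (Fin 2) (Fin 2) (ChartInf q)).det := by
    simp
  refine ⟨1, GeneralLinearGroup.mk'' _ hdinf, ?_⟩
  have h := zq_mul_invZq q
  have hzw := zz_mul_ww q
  have h1 : resInf q (v : ChartInf q) * resInf q (↑v⁻¹ : ChartInf q) = 1 := by
    rw [← map_mul, Units.mul_inv, map_one]
  have h2 : resInf q (v : ChartInf q) = ww q * res0 q (X - C q) := by
    rw [hv, resInf_one_sub]
  rw [h2] at h1
  change modificationT q 0 * (!![(↑v⁻¹ : ChartInf q), 0; 0, (v : ChartInf q)] :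
    Matrix (Fin 2) (Fin 2) (ChartInf q)).map (resInf q) =
      (1 : Matrix (Fin 2) (Fin 2) R[X]).map (res0 q) * _
  rw [Matrix.map_one _ (map_zero _) (map_one _), one_mul]
  ext i j
  fin_cases i <;> fin_cases j <;>
    simp only [modificationT, splitT, Matrix.mul_apply, Fin.sum_univ_two, map_apply, of_apply,
      cons_val', cons_val_zero, cons_val_one, cons_val_fin_one, Fin.zero_eta, Fin.mk_one,
      map_zero, h2]
  · linear_combination zz q * h1 -
      res0 q (X - C q) * resInf q (↑v⁻¹ : ChartInf q) * hzw
  · ring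
  · ring
  · linear_combination ww q ^ 2 * h

end BundleType

/-! ## The description over `X` -/

section OpenPart

variable {t : Fin 4 → ℂ} {ν : Fin 5 → ℂ} {R : Type u} [CommRing R] [Algebra ℂ R]
  (x : XPoint t ν R)

namespace XPoint

lemma inverse_mul_sub : Ring.inverse (x.k₁.q - x.k₂.q) * (x.k₁.q - x.k₂.q) = 1 :=
  Ring.inverse_mul_cancel _ (by simpa using x.isUnit_q.neg)

lemma a1_eq : x.a1 = x.lam := by
  rw [a1]
  linear_combination x.lam * x.inverse_mul_sub - Ring.inverse (x.k₁.q - x.k₂.q) * x.rel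

lemma a0_eq : x.a0 = x.k₁.p - x.lam * x.k₁.q := by
  rw [a0]
  linear_combination (x.k₁.p - x.lam * x.k₁.q) * x.inverse_mul_sub +
    Ring.inverse (x.k₁.q - x.k₂.q) * x.k₁.q * x.rel

lemma mu_eq (i : Fin 4) :
    x.toXHat.mu i = (x.k₁.u i - x.k₂.u i) * Ring.inverse (x.k₁.q - x.k₂.q) := by
  have h := x.toXHat.rel_u i
  change x.k₂.u i - x.k₁.u i = x.toXHat.mu i * (x.k₂.q - x.k₁.q) at h
  linear_combination Ring.inverse (x.k₁.q - x.k₂.q) * h - x.toXHat.mu i * x.inverse_mul_sub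

lemma toXHat_A0 : x.toXHat.A0 = x.A0 := by
  have hlin : x.toXHat.lin = C x.a1 * X + C x.a0 := by
    rw [a1_eq, a0_eq]
    rfl
  have hf : x.toXHat.f12 = x.f12 := by
    rw [f12, XHatPoint.f12, a1_eq]
    simp only [mu_eq]
    rfl
  rw [XHatPoint.A0, hlin, hf]
  rfl

/-- The product is the composite change of frame of the two modifications; written out, its inverse
and the conjugated Higgs field can be compared with the formulas over `X̂`. -/
lemma mul_P_eq : x.P1 * x.P2 * x.P3 =
    !![invZq x.k₁.q, 0; res0 x.k₁.q (C x.toXHat.slope), res0 x.k₁.q (X - C x.k₁.q)] := by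
  have h := zq_mul_invZq x.k₁.q
  have hs : (x.k₁.q - x.k₂.q) * Ring.inverse (2 * x.k₁.p) = x.toXHat.slope := rfl
  rw [P1, P2, P3, hs]
  ext i j
  fin_cases i <;> fin_cases j <;>
    simp only [Matrix.mul_apply, Fin.sum_univ_two, of_apply, cons_val', cons_val_zero, cons_val_one,
      cons_val_fin_one, Fin.zero_eta, Fin.mk_one]
  · ring
  · ring
  · linear_combination res0 x.k₁.q (C x.toXHat.slope) * h
  · ring

lemma inv_mul_P : (x.P1 * x.P2 * x.P3)⁻¹ =
    !![res0 x.k₁.q (X - C x.k₁.q), 0; -res0 x.k₁.q (C x.toXHat.slope), invZq x.k₁.q] := by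
  have h := zq_mul_invZq x.k₁.q
  apply inv_eq_left_inv
  rw [mul_P_eq]
  ext i j
  fin_cases i <;> fin_cases j <;>
    simp only [Matrix.mul_apply, Fin.sum_univ_two, of_apply, cons_val', cons_val_zero, cons_val_one,
      cons_val_fin_one, Fin.zero_eta, Fin.mk_one, one_apply_eq, ne_eq, one_ne_zero, zero_ne_one,
      not_false_eq_true, one_apply_ne]
  · linear_combination h
  · ring
  · ring
  · linear_combination h

lemma isUnit_det_P : IsUnit (x.P1 * x.P2 * x.P3).det := by
  have h := zq_mul_invZq x.k₁.q
  rw [mul_P_eq, det_fin_two_of, zero_mul, sub_zero]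
  exact (IsUnit.of_mul_eq_one_right _ h).mul (isUnit_res0_sub _)

lemma modificationT_eq :
    modificationT x.k₁.q x.toXHat.slope = (x.P1 * x.P2 * x.P3)⁻¹ * splitT x.k₁.q 0 := by
  rw [inv_mul_P]
  ext i j
  fin_cases i <;> fin_cases j <;>
    simp [modificationT, splitT, Matrix.mul_apply, mul_comm]

lemma map_A0_mul_P : x.A0.map (res0 x.k₁.q) * (x.P1 * x.P2 * x.P3) =
    (x.P1 * x.P2 * x.P3) * x.toXHat.A2.map (res0 x.k₁.q) := by
  have h := zq_mul_invZq x.k₁.q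
  have hq := congrArg (res0 x.k₁.q) x.toXHat.X_sub_C_eq
  change res0 x.k₁.q (X - C x.k₂.q) = res0 x.k₁.q ((1 - 2 * C x.toXHat.slope * C x.lam) *
    (X - C x.k₁.q) + 2 * C x.toXHat.slope * x.toXHat.lin) at hq
  simp only [map_add, map_sub, map_mul, map_one, map_ofNat] at h hq
  rw [← toXHat_A0, mul_P_eq]
  change (!![x.toXHat.lin, x.toXHat.f12; (X - C x.k₁.q) * (X - C x.k₂.q), -x.toXHat.lin] :
      Matrix (Fin 2) (Fin 2) R[X]).map (res0 x.k₁.q) * _ =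
    _ * (!![x.toXHat.lin + C x.toXHat.slope * x.toXHat.f12 * (X - C x.k₁.q),
        x.toXHat.f12 * (X - C x.k₁.q) ^ 2;
      1 - 2 * C x.toXHat.slope * C x.lam - C x.toXHat.slope ^ 2 * x.toXHat.f12,
      -(x.toXHat.lin + C x.toXHat.slope * x.toXHat.f12 * (X - C x.k₁.q))] :
        Matrix (Fin 2) (Fin 2) R[X]).map (res0 x.k₁.q)
  ext i j
  fin_cases i <;> fin_cases j <;>
    simp only [Matrix.mul_apply, Fin.sum_univ_two, map_apply, of_apply, cons_val', cons_val_zero,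
      cons_val_one, cons_val_fin_one, Fin.zero_eta, Fin.mk_one, map_neg, map_mul, map_add, map_sub,
      map_pow, map_one, map_ofNat]
  · linear_combination (-res0 x.k₁.q (C x.toXHat.slope) * res0 x.k₁.q x.toXHat.f12) * h
  · linear_combination (-res0 x.k₁.q x.toXHat.f12 *
      (res0 x.k₁.q X - res0 x.k₁.q (C x.k₁.q))) * h
  · linear_combination (res0 x.k₁.q X - res0 x.k₁.q (C x.k₂.q)) * h + hq
  · ring

lemma map_A2_eq : x.toXHat.A2.map (res0 x.k₁.q) =
    (x.P1 * x.P2 * x.P3)⁻¹ * x.A0.map (res0 x.k₁.q) * (x.P1 * x.P2 * x.P3) := by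
  rw [mul_assoc, map_A0_mul_P, nonsing_inv_mul_cancel_left _ _ x.isUnit_det_P]

/-- This is the gluing relation of the unmodified pair solved for the matrix at infinity, which both
families share. -/
lemma map_Ainf_eq (ht : Function.Injective t) :
    (x.toXHat.Ainf.map (algebraMap R[X] (ChartInf x.k₁.q))).map (resInf x.k₁.q) =
      (-(ww x.k₁.q) ^ 3) • ((splitT x.k₁.q 0)⁻¹ * x.A0.map (res0 x.k₁.q) *
        splitT x.k₁.q 0) := by
  have h : splitT x.k₁.q 0 *
      (x.toXHat.Ainf.map (algebraMap R[X] (ChartInf x.k₁.q))).map (resInf x.k₁.q) =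
      (-(ww x.k₁.q) ^ 3) • (x.toXHat.A0.map (res0 x.k₁.q) * splitT x.k₁.q 0) :=
    (x.toXHat.pair0 ht).glue
  have hd : IsUnit (splitT x.k₁.q 0).det := (x.toXHat.pair0 ht).isUnit_det_T
  rw [toXHat_A0] at h
  rw [mul_assoc, ← mul_smul_comm, ← h, nonsing_inv_mul_cancel_left _ _ hd]

end XPoint

end OpenPart

end HiggsP1

end

/-- `F₀` is the family `(𝒪 ⊕ 𝒪(-1), A⁰_z ⊗ ω_z)` and `F` the family obtained from it; both are
families over `X̂`, that is, they are given for all `R`-points of `X̂`, compatibly with base change. -/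
theorem proposition4p1 (x₁ x₂ : ℂ) (hx : Function.Injective ![0, 1, x₁, x₂])
    (ν : Fin 5 → ℂ) (hν : ∀ i, ν i ≠ 0) :
    ∃ F₀ F : ∀ (R : Type u) [CommRing R] [Algebra ℂ R]
        (x : XHatPoint ![0, 1, x₁, x₂] ν R), ParabolicHiggs ![0, 1, x₁, x₂] ν R x.k₁.q,
      -- both are families on `X̂ × ℙ¹`
      (∀ (R S : Type u) [CommRing R] [Algebra ℂ R] [CommRing S] [Algebra ℂ S] (f : R →ₐ[ℂ] S)
        (x : XHatPoint ![0, 1, x₁, x₂] ν R),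
        (F₀ R x).IsBaseChange (f : R →+* S) (F₀ S (x.map f)) ∧
        (F R x).IsBaseChange (f : R →+* S) (F S (x.map f))) ∧
      -- the explicit description over `X`
      (∀ (R : Type u) [CommRing R] [Algebra ℂ R] (x : XPoint ![0, 1, x₁, x₂] ν R),
        (F₀ R x.toXHat).T = splitT x.k₁.q 0 ∧
        (F₀ R x.toXHat).Φ₀ = x.A0 ∧
        (F R x.toXHat).T = (x.P1 * x.P2 * x.P3)⁻¹ * splitT x.k₁.q 0 ∧
        (F R x.toXHat).Φ₀.map (res0 x.k₁.q) =
          (x.P1 * x.P2 * x.P3)⁻¹ * x.A0.map (res0 x.k₁.q) * (x.P1 * x.P2 * x.P3) ∧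
        (F R x.toXHat).Φinf.map (resInf x.k₁.q) =
          (-(ww x.k₁.q) ^ 3) • ((splitT x.k₁.q 0)⁻¹ * x.A0.map (res0 x.k₁.q) *
            splitT x.k₁.q 0)) ∧
      (∀ (R : Type u) [CommRing R] [Algebra ℂ R] (x : XHatPoint ![0, 1, x₁, x₂] ν R),
        -- the lower modification followed by the upper modification at `q₁`
        (∃ E' : HiggsPair R x.k₁.q,
          (F₀ R x).toHiggsPair.IsLowerModification E'
            ((F₀ R x).toHiggsPair.eigenspaceAt x.k₁.p) ∧
          E'.IsUpperModification (F R x).toHiggsPair (E'.eigenspaceAt x.k₁.p)) ∧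
        -- the type of the underlying bundle, and the zero of the cyclic vector
        (IsUnit (x.k₁.q - x.k₂.q) → (F R x).toHiggsPair.HasBundleType 0) ∧
        (x.k₁.q = x.k₂.q →
          (F R x).toHiggsPair.HasBundleType 1 ∧
          Ideal.span (Set.range (F R x).σ₀) = Ideal.span {X - C x.k₁.q} ∧
          Ideal.span (Set.range (F R x).σinf) = ⊤)) := by 
  refine ⟨fun R _ _ x => x.family0 hx, fun R _ _ x => x.family hx,
    fun R S _ _ _ _ f x => ⟨x.family0_isBaseChange f hx, x.family_isBaseChange f hx⟩,
    fun R _ _ x => ⟨rfl, x.toXHat_A0, x.modificationT_eq, x.map_A2_eq, x.map_Ainf_eq hx⟩,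
    fun R _ _ x => ⟨⟨x.pair1 hx, x.isLowerModification_pair1 hx, x.isUpperModification_pair2 hx⟩,
      fun h => exists_modificationT_eq_of_isUnit _ (x.isUnit_slope h),
      fun h => ⟨?_, ?_, ?_⟩⟩⟩
  -- On the diagonal the slope vanishes, so the transition matrix is the diagonal one.
  · have h0 := exists_modificationT_zero_eq x.k₁.q
    rw [← x.slope_eq_zero h] at h0
    exact h0
  · change Ideal.span (Set.range ![X - C x.k₁.q, -C x.slope]) = _
    rw [x.slope_eq_zero h, C_0, neg_zero, range_cons_cons_empty, Set.pair_comm,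
      Ideal.span_insert_zero]
  -- The first coordinate of the section at infinity is `1`, so there is no zero on that chart.
  · refine (Ideal.eq_top_iff_one _).mpr (Ideal.subset_span ⟨0, ?_⟩)
    rfl
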